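/- Let $D$ be a central division $F$-algebra with involution $\ast$ (an additive anti-automorphism with $\ast\ast=\mathrm{id}$) and let $K\subseteq D$ be a subfield containing $F$ with $K^\ast\subseteq K$ and $K/F$ finite Galois with group $G$, $|G|=n$, such that $D=(K/F,\Phi)$ is a crossed product: $\Phi\colon G\times G\to K\setminus\{0\}$ is a normalized $2$-cocycle, $D$ has a right $K$-basis $(e_\sigma)_{\sigma\in G}$ with $e_{\mathrm{id}}=1$, and $(e_\sigma c)(e_\tau d)=e_{\sigma\tau}\Phi(\sigma,\tau)c^\tau d$ for $c,d\in K$ (where $c^{\sigma\tau}=(c^\sigma)^\tau$). Let $f\colon D\to K$, $f(\sum_\sigma e_\sigma c_\sigma)=c_{\mathrm{id}}$ (the unique unital $K$-$K$-bilinear map), let $\lambda\colon D\to M_n(K)$ be the left regular representation, $a[e_\sigma]_\sigma=[e_\sigma]_\sigma\lambda(a)$, let $A=[f(e_\sigma^\ast e_\tau)]_{\sigma,\tau}\in M_n(K)$, and let $X^\#=A^{-1}X^\ast A$ on $M_n(K)$, where $X^\ast$ is the conjugate transpose. For a ring $R$ with involution, a unital hermitian cone on $R$ is a set $M$ of hermitian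 elements ($m^\ast=m$) with $1\in M$, $M+M\subseteq M$, $rMr^\ast\subseteq M$ for all $r\in R$, and $M\cap -M=\{0\}$. Assume that $(M_n(K),\#)$ is formally real, i.e. every nonempty finite sum of nonzero elements of the form $XX^\#$ is nonzero. For $M\subseteq D$ put $M^c=M\cap K$; for $N\subseteq K$ put $N^e=\{c\in D : A\lambda(c) \text{ is hermitian and } x^\ast A\lambda(c)x\in N \text{ for all } x\in K^n\}$. Then for every unital hermitian cone $M$ on $D$ the following are equivalent: 1. $M$ extends to a unital hermitian cone on $(M_n(K),\#)$, i.e. $M=\lambda^{-1}(L)$ for some unital hermitian cone $L$ on $(M_n(K),\#)$; 2. $M=M^{ce}$; 3. every hermitian element $u=u^\ast$ of $D$ satisfies: $u\in M$ if and only if $f(d^\ast ud)\in M$ for all $d\in D$. If moreover $\ast|_K\neq\mathrm{id}$, these are equivalent to the condition in 3. for all (not necessarily hermitian) $u\in D$. -/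

import Mathlib

section Cones

variable {R : Type*} [Ring R]

/-- The involution `inv` on `R` is formally real: every (nonempty) finite sum of nonzero elements
of the form `r * inv r` is nonzero. -/
def IsFormallyRealInvolution (inv : R → R) : Prop :=
  ∀ (m : ℕ) (r : Fin (m + 1) → R), (∀ i, r i * inv (r i) ≠ 0) → ∑ i, r i * inv (r i) ≠ 0

/-- `M` is a unital hermitian cone on `(R, inv)`, that is, a `1`-hermitian cone containing `1`:
a set of hermitian elements with `M + M ⊆ M`, `a M a^* ⊆ M` for all `a`, `M ∩ -M = {0}`
and `1 ∈ M`. -/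
structure IsUnitalHermitianCone (inv : R → R) (M : Set R) : Prop where
  hermitian : ∀ a ∈ M, inv a = a
  add_mem : ∀ a ∈ M, ∀ b ∈ M, a + b ∈ M
  conj_mem : ∀ r : R, ∀ a ∈ M, r * a * inv r ∈ M
  zero_mem : (0 : R) ∈ M
  proper : ∀ a ∈ M, -a ∈ M → a = 0
  one_mem : (1 : R) ∈ M

end Cones

/-- A normalized 2-cocycle `Gal(K/F) × Gal(K/F) → K \ {0}`. The Galois group acts on `K` from the
right, `k ↦ k^σ = σ k`, so the composite "first `σ`, then `τ`" is Mathlib's `τ * σ`. -/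
structure IsNormalizedCocycle {F K : Type*} [Field F] [Field K] [Algebra F K]
    (Φ : Gal(K/F) → Gal(K/F) → K) : Prop where
  ne_zero : ∀ σ τ, Φ σ τ ≠ 0
  one_left : ∀ τ, Φ 1 τ = 1
  one_right : ∀ σ, Φ σ 1 = 1
  cocycle : ∀ ρ σ τ, Φ (σ * ρ) τ * τ (Φ ρ σ) = Φ ρ (τ * σ) * Φ σ τ

/-- An identification of the `F`-algebra `D` with a crossed product `(K/F, Φ)`: `K` is embedded in
`D`, the `e σ` (`σ ∈ Gal(K/F)`) form a right `K`-basis of `D` with `e 1 = 1`, `Φ` is a normalized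
cocycle, and the multiplication is `(e_σ c) (e_τ d) = e_{στ} Φ(σ, τ) c^τ d`
(with `στ` meaning "first `σ`, then `τ`"). -/
structure CrossedProduct (F K D : Type*) [Field F] [Field K] [Algebra F K] [FiniteDimensional F K]
    [Ring D] [Algebra F D] where
  /-- the embedding of `K` in `D` -/
  incl : K →ₐ[F] D
  /-- the cocycle -/
  Φ : Gal(K/F) → Gal(K/F) → K
  isNormalizedCocycle : IsNormalizedCocycle Φ
  /-- the standard right `K`-basis -/
  e : Gal(K/F) → D
  /-- the coordinates with respect to the standard basis -/
  coord : D ≃ (Gal(K/F) → K)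
  coord_symm_apply : ∀ c : Gal(K/F) → K, coord.symm c = ∑ σ, e σ * incl (c σ)
  e_one : e 1 = 1
  incl_mul_e : ∀ (k : K) (σ : Gal(K/F)), incl k * e σ = e σ * incl (σ k)
  e_mul_e : ∀ σ τ : Gal(K/F), e σ * e τ = e (τ * σ) * incl (Φ σ τ)

namespace CrossedProduct

variable {F K D : Type*} [Field F] [Field K] [Algebra F K] [FiniteDimensional F K]
  [Ring D] [Algebra F D] (P : CrossedProduct F K D)

/-- The map `f : D → K`, `f (∑ e_σ c_σ) = c_id`. It is the unique unital `K`-`K`-bilinear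
map `D → K`, see `proj_unital_bilinear` and `eq_proj`, and it is hermitian, see `proj_star`. -/
def proj (d : D) : K := P.coord d 1

/-- The left regular representation `D → M_n(K)`: `a [e_1, …, e_n] = [e_1, …, e_n] lam(a)`. -/
def lam (a : D) : Matrix Gal(K/F) Gal(K/F) K := Matrix.of fun σ τ => P.coord (a * P.e τ) σ

/-- The matrix `A = [f(e_σ^* e_τ)]`. -/
def gram [Star D] : Matrix Gal(K/F) Gal(K/F) K :=
  Matrix.of fun σ τ => P.proj (star (P.e σ) * P.e τ)

/-- The involution `X^# = A⁻¹ X^* A` on `M_n(K)`, where `X^*` is the conjugate transpose. -/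
noncomputable def sharp [Star D] [StarRing K] [DecidableEq Gal(K/F)]
    (X : Matrix Gal(K/F) Gal(K/F) K) : Matrix Gal(K/F) Gal(K/F) K :=
  P.gram⁻¹ * X.conjTranspose * P.gram

/-- The contraction `M^c = M ∩ K`, as a subset of `K`. -/
def contraction (M : Set D) : Set K := {k | P.incl k ∈ M}

/-- For `N ⊆ K`, the set `F(N)` of all hermitian matrices `B` over `K` such that `x^* B x ∈ N` for
all vectors `x`. -/
def matrixCone {K ι : Type*} [Field K] [StarRing K] [Fintype ι] (N : Set K) :
    Set (Matrix ι ι K) :=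
  {B | B.IsHermitian ∧ ∀ x : ι → K, star x ⬝ᵥ (B.mulVec x) ∈ N}

/-- The extension `N^e = {c ∈ D | A lam(c) ∈ F(N)}`. -/
def extension [Star D] [StarRing K] (N : Set K) : Set D :=
  {c | P.gram * P.lam c ∈ matrixCone N}

theorem sum_coord (d : D) : ∑ σ, P.e σ * P.incl (P.coord d σ) = d := by
  rw [← P.coord_symm_apply, Equiv.symm_apply_apply]

theorem coord_sum (c : Gal(K/F) → K) : P.coord (∑ σ, P.e σ * P.incl (c σ)) = c := by
  rw [← P.coord_symm_apply, Equiv.apply_symm_apply]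

theorem coord_add (a b : D) : P.coord (a + b) = P.coord a + P.coord b := by
  conv_lhs => rw [← P.sum_coord a, ← P.sum_coord b, ← Finset.sum_add_distrib]
  rw [← P.coord_sum (P.coord a + P.coord b)]
  simp [mul_add]

/-- `f` is additive, unital and `K`-`K`-bilinear. -/
theorem proj_unital_bilinear :
    (∀ a b, P.proj (a + b) = P.proj a + P.proj b) ∧ P.proj 1 = 1 ∧
      ∀ a b d, P.proj (P.incl a * d * P.incl b) = a * P.proj d * b := by
  classical
  refine ⟨fun a b => ?_, ?_, fun a b d => ?_⟩
  · simp [proj, coord_add]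
  · have h := P.coord_sum (Pi.single 1 1)
    rw [Finset.sum_eq_single 1 (by intro σ _ h; simp [h]) (by simp)] at h
    simp only [Pi.single_eq_same, map_one, mul_one, P.e_one] at h
    simp [proj, h]
  · have h := P.coord_sum (fun σ => σ a * P.coord d σ * b)
    have h2 : ∑ σ, P.e σ * P.incl (σ a * P.coord d σ * b) = P.incl a * d * P.incl b := by
      conv_rhs => rw [← P.sum_coord d]
      rw [Finset.mul_sum, Finset.sum_mul]
      refine Finset.sum_congr rfl fun σ _ => ?_
      rw [map_mul, map_mul, ← mul_assoc, ← mul_assoc, ← P.incl_mul_e]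
      simp only [mul_assoc]
    rw [h2] at h
    simp [proj, h]

/-- `f` is the only additive, unital, `K`-`K`-bilinear map `D → K`. -/
theorem eq_proj (g : D → K) (hadd : ∀ a b, g (a + b) = g a + g b) (hone : g 1 = 1)
    (hbil : ∀ a b d, g (P.incl a * d * P.incl b) = a * g d * b) : g = P.proj := by
  classical
  have he : ∀ σ : Gal(K/F), σ ≠ 1 → g (P.e σ) = 0 := by
    intro σ hσ
    by_contra h0
    apply hσ
    ext k
    have h1 := hbil k 1 (P.e σ)
    have h2 := hbil 1 (σ k) (P.e σ)
    simp only [map_one, mul_one, one_mul] at h1 h2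
    rw [P.incl_mul_e, h2, mul_comm] at h1
    simpa using mul_right_cancel₀ h0 h1
  funext d
  let G : D →+ K := AddMonoidHom.mk' g hadd
  have : G d = ∑ σ, G (P.e σ * P.incl (P.coord d σ)) := by
    rw [← map_sum, P.sum_coord]
  change g d = _
  change g d = ∑ σ, g (P.e σ * P.incl (P.coord d σ)) at this
  have hr : ∀ (d : D) b, g (d * P.incl b) = g d * b := by
    intro d b; simpa using hbil 1 b d
  rw [this, Finset.sum_eq_single 1]
  · rw [hr, P.e_one, hone, one_mul, proj]
  · intro σ _ h; rw [hr, he σ h, zero_mul]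
  · simp

/-- `f` is hermitian. -/
theorem proj_star [StarRing D] [StarRing K] (hK : ∀ k, P.incl (star k) = star (P.incl k))
    (d : D) : P.proj (star d) = star (P.proj d) := by
  obtain ⟨h1, h2, h3⟩ := P.proj_unital_bilinear
  have := P.eq_proj (fun d => star (P.proj (star d))) (by simp [h1]) (by simp [h2])
    (fun a b d => by
      have := h3 (star b) (star a) (star d)
      simp only [hK] at this
      simp [star_mul, ← mul_assoc, this, mul_comm])
  have h := congrFun this d
  rw [← h, star_star]

end CrossedProduct

open Matrix

/-! ### Hermitian forms over a field with involution -/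

section HermitianMatrix

variable {K ι : Type*} [Field K] [StarRing K] [Fintype ι]

/-! In coordinates `A λ(u)` is the matrix of the form `(c, d) ↦ f(c^* u d)` (`gram_mul_lam_form`).
Hence `u ∈ N^e` means that `u` is hermitian and all `f(d^* u d)` lie in `N`, so 2 and 3 say the same
thing. Given 2, `L = {B | A B ∈ F(M^c)}` is a cone restricting to `M`.

Now let `M = λ⁻¹(L)`. Conjugation by rank-one matrices puts `f(d^* u d) • p p^* A` in `L` whenever
`λ(u) ∈ L` (`form_smul_mem`). If all values `f(d^* u d)` lie in `M`, diagonalizing the hermitian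
form `A λ(u)` writes `λ(u)` as a sum of such elements (`lam_mem_of_form_mem`). Conversely, formal
reality makes `A` diagonal (`gram_eq_zero_of_ne`), and then `λ(f(d^* u d))` is a sum of them as well
(`lam_proj_mem`). -/

theorem Matrix.star_sesquilinear_form (B : Matrix ι ι K) (x y : ι → K) :
    star (star x ⬝ᵥ B *ᵥ y) = star y ⬝ᵥ Bᴴ *ᵥ x := by
  rw [← star_dotProduct_star, star_star, star_mulVec, ← dotProduct_mulVec]

theorem Matrix.IsHermitian.star_form {B : Matrix ι ι K} (hB : B.IsHermitian) (x y : ι → K) :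
    star (star x ⬝ᵥ B *ᵥ y) = star y ⬝ᵥ B *ᵥ x := by
  rw [star_sesquilinear_form, hB.eq]

theorem Matrix.eq_zero_of_sesquilinear_form [DecidableEq ι] {B : Matrix ι ι K}
    (h : ∀ x y : ι → K, star x ⬝ᵥ B *ᵥ y = 0) : B = 0 := by
  ext i j
  simpa [Pi.star_single] using h (Pi.single i 1) (Pi.single j 1)

/-- In characteristic different from 2, a hermitian matrix whose form is zero is zero. -/
theorem Matrix.IsHermitian.eq_zero_of_form [DecidableEq ι] (h2 : (2 : K) ≠ 0) {B : Matrix ι ι K}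
    (hB : B.IsHermitian) (h : ∀ x : ι → K, star x ⬝ᵥ B *ᵥ x = 0) : B = 0 := by
  refine eq_zero_of_sesquilinear_form fun x y => ?_
  by_contra h0
  set c := star x ⬝ᵥ B *ᵥ y with hc
  -- With `y` rescaled to pair to 1 with `x`, polarization gives `1 + 1 = 0`.
  have h1 : star x ⬝ᵥ B *ᵥ (c⁻¹ • y) = 1 := by
    rw [mulVec_smul, dotProduct_smul, ← hc, smul_eq_mul, inv_mul_cancel₀ h0]
  have h3 : star (c⁻¹ • y) ⬝ᵥ B *ᵥ x = 1 := by rw [← hB.star_form, h1, star_one]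
  have h4 := h (x + c⁻¹ • y)
  rw [star_add, mulVec_add, add_dotProduct, dotProduct_add, dotProduct_add, h, h, h1, h3] at h4
  exact h2 (by linear_combination h4)

/-- If the involution is nontrivial, a matrix with hermitian values is hermitian. -/
theorem Matrix.isHermitian_of_form [DecidableEq ι] {k : K} (hk : star k ≠ k) {B : Matrix ι ι K}
    (h : ∀ x : ι → K, star (star x ⬝ᵥ B *ᵥ x) = star x ⬝ᵥ B *ᵥ x) : B.IsHermitian := by
  have hz : ∀ x : ι → K, star x ⬝ᵥ (Bᴴ - B) *ᵥ x = 0 := by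
    intro x
    rw [sub_mulVec, dotProduct_sub, sub_eq_zero, ← star_sesquilinear_form, h x]
  have hp : ∀ x y : ι → K, star x ⬝ᵥ (Bᴴ - B) *ᵥ y + star y ⬝ᵥ (Bᴴ - B) *ᵥ x = 0 := by
    intro x y
    have h4 := hz (x + y)
    rw [star_add, mulVec_add, add_dotProduct, dotProduct_add, dotProduct_add, hz, hz] at h4
    linear_combination h4
  refine sub_eq_zero.mp (eq_zero_of_sesquilinear_form fun x y => ?_)
  -- The form of `Bᴴ - B` is alternating; scaling `y` by `k` and subtracting `star k` times the
  -- unscaled relation isolates one term.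
  have h5 := hp x (k • y)
  rw [mulVec_smul, dotProduct_smul, star_smul, smul_dotProduct, smul_eq_mul, smul_eq_mul] at h5
  have h6 : (k - star k) * (star x ⬝ᵥ (Bᴴ - B) *ᵥ y) = 0 := by
    linear_combination h5 - star k * hp x y
  exact (mul_eq_zero.mp h6).resolve_left (sub_ne_zero.mpr hk.symm)

/-- In characteristic different from 2, a hermitian matrix whose form has values in `N` is a sum
of matrices `p a p^*` with `a ∈ N`. -/
theorem Matrix.IsHermitian.mem_of_form_mem [DecidableEq ι] (h2 : (2 : K) ≠ 0) {N : Set K}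
    {T : Set (Matrix ι ι K)} (h0 : 0 ∈ T) (hadd : ∀ a ∈ T, ∀ b ∈ T, a + b ∈ T)
    (hN : ∀ a ∈ N, ∀ p : ι → K, a • vecMulVec p (star p) ∈ T) {B : Matrix ι ι K}
    (hB : B.IsHermitian) (h : ∀ x : ι → K, star x ⬝ᵥ B *ᵥ x ∈ N) : B ∈ T := by
  -- Gram-Schmidt: splitting off one rank-one piece strictly enlarges the kernel.
  induction hV : LinearMap.ker B.mulVecLin using WellFoundedGT.induction generalizing B with
  | _ V ih =>
    by_cases hz : ∀ x : ι → K, star x ⬝ᵥ B *ᵥ x = 0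
    · rwa [hB.eq_zero_of_form h2 hz]
    push Not at hz
    obtain ⟨w, hw⟩ := hz
    set a := star w ⬝ᵥ B *ᵥ w with ha
    have has : star a = a := hB.star_form w w
    -- Chosen so that `C = a p p^*` agrees with `B` on `w` and vanishes on `ker B`. The form of `B -
    -- C` at `x` is that of `B` at the component of `x` orthogonal to `w`, so its values stay in
    -- `N`.
    set p := a⁻¹ • B *ᵥ w with hp
    have hpx : ∀ x, star p ⬝ᵥ x = a⁻¹ * (star w ⬝ᵥ B *ᵥ x) := by
      intro x
      rw [hp, star_smul, smul_dotProduct, star_inv₀, has, smul_eq_mul, star_mulVec, hB.eq,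
        ← dotProduct_mulVec]
    set C := a • vecMulVec p (star p) with hC
    have hCh : C.IsHermitian := by
      rw [IsHermitian, hC, conjTranspose_smul, has, conjTranspose_vecMulVec, star_star]
    have hCx : ∀ x, C *ᵥ x = (star p ⬝ᵥ x) • B *ᵥ w := by
      intro x
      rw [hC, smul_mulVec, vecMulVec_mulVec, hp]
      ext i
      simp
      field_simp
    rw [← sub_add_cancel B C]
    refine hadd _ ?_ _ (hN a (h w) p)
    have hval : ∀ x, (B - C) *ᵥ x = B *ᵥ (x - (star p ⬝ᵥ x) • w) := by
      intro x
      rw [sub_mulVec, hCx, mulVec_sub, mulVec_smul]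
    refine ih _ ?_ (hB.sub hCh) (fun x => ?_) rfl
    · rw [← hV]
      refine lt_of_le_of_ne (fun x hx => ?_) fun heq => ?_
      · simp only [LinearMap.mem_ker, mulVecLin_apply] at hx ⊢
        rw [sub_mulVec, hCx, hpx, hx]
        simp
      · have hwm : w ∈ LinearMap.ker (B - C).mulVecLin := by
          simp only [LinearMap.mem_ker, mulVecLin_apply]
          rw [hval, hpx, ← ha, inv_mul_cancel₀ hw]
          simp
        rw [← heq] at hwm
        simp only [LinearMap.mem_ker, mulVecLin_apply] at hwm
        rw [hwm] at ha
        exact hw (by simpa using ha)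
    · have hx := h (x - (star p ⬝ᵥ x) • w)
      rw [← hval, star_sub, sub_dotProduct] at hx
      have hzero : star ((star p ⬝ᵥ x) • w) ⬝ᵥ (B - C) *ᵥ x = 0 := by
        rw [star_smul, smul_dotProduct, sub_mulVec, dotProduct_sub, hCx, hpx, dotProduct_smul,
          ← ha, smul_eq_mul, smul_eq_mul, mul_right_comm, inv_mul_cancel₀ hw, one_mul, sub_self,
          mul_zero]
      rwa [hzero, sub_zero] at hx

end HermitianMatrix

/-! ### Coordinates and the regular representation -/

namespace CrossedProduct

variable {F K D : Type*} [Field F] [Field K] [Algebra F K] [FiniteDimensional F K]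

section Ring

variable [Ring D] [Algebra F D] (P : CrossedProduct F K D)

theorem coord_mul_incl (d : D) (k : K) (σ : Gal(K/F)) :
    P.coord (d * P.incl k) σ = P.coord d σ * k := by
  have h := P.coord_sum fun σ => P.coord d σ * k
  simp only [map_mul, ← mul_assoc, ← Finset.sum_mul, P.sum_coord] at h
  exact congrFun h σ

theorem coord_finset_sum {ι : Type*} (s : Finset ι) (g : ι → D) :
    P.coord (∑ i ∈ s, g i) = ∑ i ∈ s, P.coord (g i) :=
  map_sum (AddMonoidHom.mk' P.coord P.coord_add) g s

theorem lam_mulVec_coord (a d : D) : P.lam a *ᵥ P.coord d = P.coord (a * d) := by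
  ext σ
  conv_rhs => rw [← P.sum_coord d, Finset.mul_sum, coord_finset_sum]
  simp [mulVec, dotProduct, lam, ← mul_assoc, coord_mul_incl]

theorem ext_mulVec_coord {ι : Type*} {X Y : Matrix ι Gal(K/F) K}
    (h : ∀ d, X *ᵥ P.coord d = Y *ᵥ P.coord d) : X = Y := by
  classical
  refine ext_of_mulVec_single fun σ => ?_
  simpa using h (P.coord.symm (Pi.single σ 1))

theorem lam_one [DecidableEq Gal(K/F)] : P.lam 1 = 1 :=
  P.ext_mulVec_coord fun d => by rw [lam_mulVec_coord, one_mul, one_mulVec]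

theorem lam_injective : Function.Injective P.lam := fun a b h => by
  have := P.lam_mulVec_coord a 1
  rw [h, lam_mulVec_coord] at this
  simpa using this.symm

theorem coord_e [DecidableEq Gal(K/F)] (σ : Gal(K/F)) : P.coord (P.e σ) = Pi.single σ 1 := by
  rw [← P.coord_sum (Pi.single σ 1), Finset.sum_eq_single σ (by intro τ _ h; simp [h]) (by simp)]
  simp

theorem lam_incl [DecidableEq Gal(K/F)] (k : K) :
    P.lam (P.incl k) = diagonal fun σ : Gal(K/F) => σ k := by
  ext σ τ
  rw [lam, of_apply, incl_mul_e, coord_mul_incl, coord_e, diagonal_apply, Pi.single_apply]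
  split_ifs with h <;> simp [h]

theorem proj_incl (k : K) : P.proj (P.incl k) = k := by
  obtain ⟨-, h1, h⟩ := P.proj_unital_bilinear
  simpa [h1] using h k 1 1

theorem ext_form [StarRing K] {X Y : Matrix Gal(K/F) Gal(K/F) K}
    (h : ∀ c d, star (P.coord c) ⬝ᵥ X *ᵥ P.coord d = star (P.coord c) ⬝ᵥ Y *ᵥ P.coord d) :
    X = Y := by
  classical
  refine sub_eq_zero.mp (eq_zero_of_sesquilinear_form fun x y => ?_)
  have := h (P.coord.symm x) (P.coord.symm y)
  rw [Equiv.apply_symm_apply, Equiv.apply_symm_apply] at this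
  rw [sub_mulVec, dotProduct_sub, this, sub_self]

end Ring

end CrossedProduct
-- The Gram matrix and its form
namespace CrossedProduct

variable {F K D : Type*} [Field F] [Field K] [Algebra F K] [FiniteDimensional F K]

section Form

variable [Ring D] [Algebra F D] [StarRing D] (P : CrossedProduct F K D)

theorem gram_one_one : P.gram 1 1 = 1 := by
  rw [gram, of_apply, P.e_one, star_one, one_mul, P.proj_unital_bilinear.2.1]

variable [StarRing K]

theorem gram_form (hK : ∀ k : K, P.incl (star k) = star (P.incl k)) (c d : D) :
    star (P.coord c) ⬝ᵥ P.gram *ᵥ P.coord d = P.proj (star c * d) := by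
  obtain ⟨hadd, -, hbil⟩ := P.proj_unital_bilinear
  have hsum : ∀ g : Gal(K/F) → D, P.proj (∑ σ, g σ) = ∑ σ, P.proj (g σ) := fun g =>
    map_sum (AddMonoidHom.mk' P.proj hadd) g _
  conv_rhs => rw [← P.sum_coord c, ← P.sum_coord d, star_sum, Finset.sum_mul, hsum]
  refine Finset.sum_congr rfl fun σ _ => ?_
  rw [Finset.mul_sum, hsum, mulVec, dotProduct, Finset.mul_sum]
  refine Finset.sum_congr rfl fun τ _ => ?_
  have h := hbil (star (P.coord c σ)) (P.coord d τ) (star (P.e σ) * P.e τ)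
  rw [hK] at h
  rw [star_mul, gram, of_apply, Pi.star_apply, ← mul_assoc, ← h]
  simp only [mul_assoc]

theorem gram_mul_lam_form (hK : ∀ k : K, P.incl (star k) = star (P.incl k)) (u c d : D) :
    star (P.coord c) ⬝ᵥ (P.gram * P.lam u) *ᵥ P.coord d = P.proj (star c * u * d) := by
  rw [← mulVec_mulVec, lam_mulVec_coord, P.gram_form hK, mul_assoc]

theorem gram_isHermitian (hK : ∀ k : K, P.incl (star k) = star (P.incl k)) :
    P.gram.IsHermitian := by
  ext σ τ
  rw [conjTranspose_apply, gram, of_apply, of_apply, ← P.proj_star hK, star_mul, star_star]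

theorem gram_mul_lam_star (hK : ∀ k : K, P.incl (star k) = star (P.incl k)) (u : D) :
    P.gram * P.lam (star u) = (P.gram * P.lam u)ᴴ :=
  P.ext_form fun c d => by
    rw [P.gram_mul_lam_form hK, ← star_sesquilinear_form, P.gram_mul_lam_form hK,
      ← P.proj_star hK]
    simp [mul_assoc]

theorem star_mul_incl_mul (hK : ∀ k : K, P.incl (star k) = star (P.incl k)) (σ : Gal(K/F))
    (k : K) : star (P.e σ) * P.incl k = P.incl (star (σ (star k))) * star (P.e σ) := by
  rw [hK, ← star_mul, ← incl_mul_e, star_mul, ← hK, star_star]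

/-- The Gram matrix is supported on the pairs `(σ, τ)` with `τ = * σ *`. -/
theorem apply_eq_of_gram_ne_zero (hK : ∀ k : K, P.incl (star k) = star (P.incl k))
    {σ τ : Gal(K/F)} (h : P.gram σ τ ≠ 0) (k : K) : τ k = star (σ (star k)) := by
  obtain ⟨-, -, hbil⟩ := P.proj_unital_bilinear
  have h1 := hbil (star (σ (star k))) 1 (star (P.e σ) * P.e τ)
  rw [map_one, mul_one, mul_one, ← mul_assoc, ← P.star_mul_incl_mul hK, mul_assoc, incl_mul_e,
    ← mul_assoc] at h1
  have h2 := hbil 1 (τ k) (star (P.e σ) * P.e τ)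
  rw [map_one, one_mul, one_mul, h1, mul_comm] at h2
  exact (mul_left_cancel₀ (a := P.gram σ τ) h (by simpa [gram] using h2)).symm

/-- Since `A_σσ ≠ 0`, `σ` commutes with `*`, so `v ↦ σ⁻¹(A_σσ⁻¹ f(e_σ^* v e_σ))` is unital and
`K`-`K`-bilinear; by uniqueness it is `f`. -/
theorem proj_star_e_mul_mul_e (hK : ∀ k : K, P.incl (star k) = star (P.incl k))
    {σ : Gal(K/F)} (h : P.gram σ σ ≠ 0) (v : D) :
    P.proj (star (P.e σ) * v * P.e σ) = P.gram σ σ * σ (P.proj v) := by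
  obtain ⟨hadd, -, hbil⟩ := P.proj_unital_bilinear
  have key := P.eq_proj
    (fun v => σ.symm ((P.gram σ σ)⁻¹ * P.proj (star (P.e σ) * v * P.e σ)))
    (fun a b => by simp [mul_add, add_mul, hadd])
    (by
      have h1 : P.proj (star (P.e σ) * P.e σ) = P.gram σ σ := rfl
      simp only [mul_one]
      rw [h1, inv_mul_cancel₀ h, map_one])
    (fun a b d => by
      have h1 : star (P.e σ) * (P.incl a * d * P.incl b) * P.e σ =
          P.incl (σ a) * (star (P.e σ) * d * P.e σ) * P.incl (σ b) := by
        rw [P.apply_eq_of_gram_ne_zero hK h a, mul_assoc, mul_assoc _ (P.incl b), incl_mul_e]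
        simp only [← mul_assoc]
        rw [P.star_mul_incl_mul hK]
      simp only [h1, hbil]
      rw [σ.symm_apply_eq]
      simp only [map_mul, AlgEquiv.apply_symm_apply]
      ring)
  rw [← congrFun key v, AlgEquiv.apply_symm_apply, mul_inv_cancel_left₀ h]

theorem mem_extension_iff [DecidableEq Gal(K/F)] (hK : ∀ k : K, P.incl (star k) = star (P.incl k))
    (hA : IsUnit P.gram) {N : Set K} {u : D} :
    u ∈ P.extension N ↔ star u = u ∧ ∀ d, P.proj (star d * u * d) ∈ N := by
  rw [extension, Set.mem_ofPred_eq, matrixCone, Set.mem_ofPred_eq, IsHermitian,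
    ← P.gram_mul_lam_star hK, hA.mul_right_inj, P.lam_injective.eq_iff,
    P.coord.surjective.forall]
  simp only [P.gram_mul_lam_form hK]

end Form

section Division

variable [DivisionRing D] [Algebra F D] [DecidableEq Gal(K/F)] [StarRing D] [StarRing K]
  (P : CrossedProduct F K D)

/-- If `A` killed the coordinates of `d ≠ 0`, pairing with `(d⁻¹)^*` would give `f(d⁻¹ d) = 1 = 0`.
-/
theorem isUnit_gram (hK : ∀ k : K, P.incl (star k) = star (P.incl k)) : IsUnit P.gram := by
  rw [← mulVec_injective_iff_isUnit]
  refine (injective_iff_map_eq_zero P.gram.mulVecLin).mpr fun x hx => ?_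
  obtain ⟨d, rfl⟩ := P.coord.surjective x
  by_contra hd
  have hd0 : d ≠ 0 := by
    rintro rfl
    exact hd (by simpa using P.coord_add 0 0)
  have h := P.gram_form hK (star d⁻¹) d
  rw [mulVecLin_apply] at hx
  rw [hx, star_star, inv_mul_cancel₀ hd0, P.proj_unital_bilinear.2.1] at h
  simp at h

theorem sharp_eq_self_iff (hA : IsUnit P.gram) (hh : P.gram.IsHermitian)
    (B : Matrix Gal(K/F) Gal(K/F) K) : P.sharp B = B ↔ (P.gram * B).IsHermitian := by
  have hdet := (isUnit_iff_isUnit_det _).mp hA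
  rw [IsHermitian, conjTranspose_mul, hh.eq, ← hA.mul_right_inj, sharp, mul_assoc,
    mul_nonsing_inv_cancel_left _ _ hdet]

theorem gram_mul_conj_sharp (hA : IsUnit P.gram) (X B : Matrix Gal(K/F) Gal(K/F) K) :
    P.gram * (X * B * P.sharp X) =
      (P.gram * X * P.gram⁻¹) * (P.gram * B) * (P.gram⁻¹ * Xᴴ * P.gram) := by
  have hdet := (isUnit_iff_isUnit_det _).mp hA
  simp only [sharp, mul_assoc, nonsing_inv_mul_cancel_left _ _ hdet]

/-- A rank-one conjugation collapses `B` to a single value of the form `A B`; this carries form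
values into a cone. -/
theorem conj_sharp_vecMulVec (hA : IsUnit P.gram) (hh : P.gram.IsHermitian)
    (p y : Gal(K/F) → K) (B : Matrix Gal(K/F) Gal(K/F) K) :
    vecMulVec p (star (P.gram *ᵥ y)) * B * P.sharp (vecMulVec p (star (P.gram *ᵥ y))) =
      (star y ⬝ᵥ (P.gram * B) *ᵥ y) • (vecMulVec p (star p) * P.gram) := by
  have hdet := (isUnit_iff_isUnit_det _).mp hA
  rw [sharp, conjTranspose_vecMulVec, star_star, mul_vecMulVec, mulVec_mulVec,
    nonsing_inv_mul _ hdet, one_mulVec, vecMulVec_mul, star_mulVec, hh.eq, vecMul_vecMul,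
    ← mul_assoc, vecMulVec_mul_vecMulVec, dotProduct_mulVec, vecMulVec_smul, smul_mul]

/-- If `#` is formally real, then the Gram matrix is diagonal: otherwise its form would contain a
hyperbolic plane. -/
theorem gram_eq_zero_of_ne (hK : ∀ k : K, P.incl (star k) = star (P.incl k)) (h2 : (2 : K) ≠ 0)
    (hreal : IsFormallyRealInvolution P.sharp) {σ τ : Gal(K/F)} (hστ : σ ≠ τ) :
    P.gram σ τ = 0 := by
  by_contra h
  have hh := P.gram_isHermitian hK
  have hA := P.isUnit_gram hK
  have h' : P.gram τ σ = star (P.gram σ τ) := (hh.apply τ σ).symm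
  have hσ : P.gram σ σ = 0 := by
    -- Two nonzero entries in one row would both have column index `* σ *`, forcing `σ = τ`.
    by_contra h0
    exact hστ (AlgEquiv.ext fun k => by
      rw [P.apply_eq_of_gram_ne_zero hK h k, ← P.apply_eq_of_gram_ne_zero hK h0 k])
  have hτ : P.gram τ τ = 0 := by
    by_contra h0
    exact hστ (AlgEquiv.ext fun k => by
      rw [P.apply_eq_of_gram_ne_zero hK h0 k,
        ← P.apply_eq_of_gram_ne_zero hK (h' ▸ star_ne_zero.mpr h) k])
  -- On the plane of `σ, τ` the form is hyperbolic; `b = ±A_στ⁻¹` gives the values `±2`, whose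
  -- squares `X X^#` cancel.
  let y : K → Gal(K/F) → K := fun b => Pi.single σ 1 + Pi.single τ b
  have hy : ∀ b, star (y b) ⬝ᵥ P.gram *ᵥ y b = P.gram σ τ * b + star (P.gram σ τ * b) := by
    intro b
    simp [y, mulVec_add, Pi.star_single, hσ, hτ, h', mul_comm, add_comm]
  let X : K → Matrix Gal(K/F) Gal(K/F) K :=
    fun b => vecMulVec (Pi.single 1 1) (star (P.gram *ᵥ y b))
  let E : Matrix Gal(K/F) Gal(K/F) K := vecMulVec (Pi.single 1 1) (star (Pi.single 1 1)) * P.gram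
  have hX : ∀ b, X b * P.sharp (X b) = (P.gram σ τ * b + star (P.gram σ τ * b)) • E := by
    intro b
    have := P.conj_sharp_vecMulVec hA hh (Pi.single 1 1) (y b) 1
    rwa [mul_one, mul_one, hy] at this
  have hE : E ≠ 0 := fun h0 => by
    have := congrFun (congrFun h0 1) 1
    simp [E, vecMulVec_mul, vecMulVec_apply, Pi.star_single, gram_one_one] at this
  have hpos : X (P.gram σ τ)⁻¹ * P.sharp (X (P.gram σ τ)⁻¹) = (2 : K) • E := by
    rw [hX, mul_inv_cancel₀ h, star_one, one_add_one_eq_two]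
  have hneg : X (-(P.gram σ τ)⁻¹) * P.sharp (X (-(P.gram σ τ)⁻¹)) = -((2 : K) • E) := by
    rw [hX, mul_neg, mul_inv_cancel₀ h, star_neg, star_one, ← neg_add, one_add_one_eq_two,
      neg_smul]
  have h2E : (2 : K) • E ≠ 0 := smul_ne_zero h2 hE
  refine hreal 1 ![X (P.gram σ τ)⁻¹, X (-(P.gram σ τ)⁻¹)]
    (Fin.forall_fin_two.mpr ⟨hpos.trans_ne h2E, hneg.trans_ne (neg_ne_zero.mpr h2E)⟩)
    ((Fin.sum_univ_two _).trans ?_)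
  exact (congrArg₂ (· + ·) hpos hneg).trans (add_neg_cancel _)

end Division
end CrossedProduct
-- Extending and contracting cones
namespace CrossedProduct

section Division

variable {F K D : Type*} [Field F] [Field K] [Algebra F K] [FiniteDimensional F K]
  [DivisionRing D] [Algebra F D] [StarRing D]

/-- In characteristic 2, `1 = -1` would violate properness. -/
theorem two_ne_zero_of_cone (P : CrossedProduct F K D) {M : Set D} (hM : IsUnitalHermitianCone (star : D → D) M) :
    (2 : K) ≠ 0 := fun h => by
  have h1 : (2 : D) = 0 := by
    have := congrArg P.incl h
    rwa [map_ofNat, map_zero] at this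
  have h3 : (-1 : D) = 1 := neg_eq_of_add_eq_zero_left (by rw [one_add_one_eq_two, h1])
  exact one_ne_zero (hM.proper 1 hM.one_mem (h3.symm ▸ hM.one_mem))

variable [StarRing K] (P : CrossedProduct F K D)

theorem eq_extension_iff [DecidableEq Gal(K/F)]
    (hK : ∀ k : K, P.incl (star k) = star (P.incl k)) {M : Set D}
    (hM : IsUnitalHermitianCone (star : D → D) M) :
    M = P.extension (P.contraction M) ↔
      ∀ u : D, star u = u → (u ∈ M ↔ ∀ d : D, P.incl (P.proj (star d * u * d)) ∈ M) := by
  simp only [Set.ext_iff, P.mem_extension_iff hK (P.isUnit_gram hK)]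
  refine forall_congr' fun u => ⟨fun h hu => h.trans (and_iff_right hu), fun h => ?_⟩
  exact ⟨fun hu => ⟨hM.hermitian u hu, (h (hM.hermitian u hu)).mp hu⟩,
    fun hu => (h hu.1).mpr hu.2⟩

theorem star_eq_self_of_form [DecidableEq Gal(K/F)]
    (hK : ∀ k : K, P.incl (star k) = star (P.incl k)) {k : K} (hk : star k ≠ k) {u : D}
    (h : ∀ d, star (P.proj (star d * u * d)) = P.proj (star d * u * d)) : star u = u := by
  apply P.lam_injective
  rw [← (P.isUnit_gram hK).mul_right_inj, P.gram_mul_lam_star hK]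
  refine isHermitian_of_form hk (P.coord.surjective.forall.mpr fun d => ?_)
  rw [P.gram_mul_lam_form hK, h]

/-- `B ↦ X B X^#` acts on `A B` as the congruence by `A⁻¹ X^* A`. The hypothesis `M = M^{ce}` serves
only to give `1 ∈ L`. -/
theorem extension_contraction_extends [DecidableEq Gal(K/F)]
    (hK : ∀ k : K, P.incl (star k) = star (P.incl k)) {M : Set D}
    (hM : IsUnitalHermitianCone (star : D → D) M) (h : M = P.extension (P.contraction M)) :
    IsUnitalHermitianCone P.sharp {B | P.gram * B ∈ matrixCone (P.contraction M)} := by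
  have hA := P.isUnit_gram hK
  have hh := P.gram_isHermitian hK
  refine ⟨fun B hB => (P.sharp_eq_self_iff hA hh B).mpr hB.1, fun B hB C hC => ?_,
    fun X B hB => ?_, ?_, fun B hB hB' => ?_, ?_⟩
  · refine ⟨?_, fun x => ?_⟩
    · rw [mul_add]
      exact hB.1.add hC.1
    · rw [mul_add, add_mulVec, dotProduct_add, contraction, Set.mem_ofPred_eq, map_add]
      exact hM.add_mem _ (hB.2 x) _ (hC.2 x)
  · have hX : P.gram * (X * B * P.sharp X) =
        (P.gram⁻¹ * Xᴴ * P.gram)ᴴ * (P.gram * B) * (P.gram⁻¹ * Xᴴ * P.gram) := by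
      rw [P.gram_mul_conj_sharp hA, conjTranspose_mul, conjTranspose_mul,
        conjTranspose_conjTranspose, conjTranspose_nonsing_inv, hh.eq, mul_assoc P.gram]
    rw [Set.mem_ofPred_eq, hX]
    refine ⟨isHermitian_conjTranspose_mul_mul _ hB.1, fun x => ?_⟩
    have := hB.2 ((P.gram⁻¹ * Xᴴ * P.gram) *ᵥ x)
    rwa [star_mulVec, ← dotProduct_mulVec, mulVec_mulVec, mulVec_mulVec] at this
  · rw [Set.mem_ofPred_eq, mul_zero]
    refine ⟨conjTranspose_zero, fun x => ?_⟩
    rw [zero_mulVec, dotProduct_zero, contraction, Set.mem_ofPred_eq, map_zero]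
    exact hM.zero_mem
  · have h0 : P.gram * B = 0 := hB.1.eq_zero_of_form (P.two_ne_zero_of_cone hM) fun x => by
      have h1 := hM.proper _ (hB.2 x) (by
        have := hB'.2 x
        rwa [mul_neg, neg_mulVec, dotProduct_neg, contraction, Set.mem_ofPred_eq, map_neg] at this)
      exact P.incl.toRingHom.injective (h1.trans (map_zero P.incl).symm)
    exact hA.mul_right_injective (h0.trans (mul_zero _).symm)
  · have h1 : (1 : D) ∈ P.extension (P.contraction M) := h ▸ hM.one_mem
    rwa [extension, Set.mem_ofPred_eq, lam_one] at h1

theorem form_smul_mem [DecidableEq Gal(K/F)]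
    (hK : ∀ k : K, P.incl (star k) = star (P.incl k)) {L : Set (Matrix Gal(K/F) Gal(K/F) K)}
    (hL : IsUnitalHermitianCone P.sharp L) {u : D} (hu : P.lam u ∈ L) (d : D)
    (p : Gal(K/F) → K) :
    P.proj (star d * u * d) • (vecMulVec p (star p) * P.gram) ∈ L := by
  rw [← P.gram_mul_lam_form hK,
    ← P.conj_sharp_vecMulVec (P.isUnit_gram hK) (P.gram_isHermitian hK)]
  exact hL.conj_mem _ _ hu

theorem lam_mem_of_form_mem [DecidableEq Gal(K/F)]
    (hK : ∀ k : K, P.incl (star k) = star (P.incl k)) (h2 : (2 : K) ≠ 0)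
    {L : Set (Matrix Gal(K/F) Gal(K/F) K)} (hL : IsUnitalHermitianCone P.sharp L) {u : D}
    (hu : star u = u) (h : ∀ d, P.lam (P.incl (P.proj (star d * u * d))) ∈ L) :
    P.lam u ∈ L := by
  have hA := P.isUnit_gram hK
  have hdet := (isUnit_iff_isUnit_det _).mp hA
  have hB : (P.gram * P.lam u).IsHermitian := by
    rw [IsHermitian, ← P.gram_mul_lam_star hK, hu]
  have := hB.mem_of_form_mem h2 (N := P.contraction (P.lam ⁻¹' L)) (T := {C | P.gram⁻¹ * C ∈ L})
    (by simpa using hL.zero_mem)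
    (fun a ha b hb => by
      rw [Set.mem_ofPred_eq, mul_add]
      exact hL.add_mem _ ha _ hb)
    (fun a ha p => by
      -- The vector `A⁻¹ p` turns `p p^* A` into `A⁻¹ p p^*`.
      have := P.form_smul_mem hK hL ha 1 (P.gram⁻¹ *ᵥ p)
      rw [star_one, one_mul, mul_one, proj_incl, star_mulVec, conjTranspose_nonsing_inv,
        (P.gram_isHermitian hK).eq, vecMulVec_mul, vecMul_vecMul, nonsing_inv_mul _ hdet,
        vecMul_one] at this
      rwa [Set.mem_ofPred_eq, Matrix.mul_smul, mul_vecMulVec])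
    (P.coord.surjective.forall.mpr fun d => by
      rw [P.gram_mul_lam_form hK]
      exact h d)
  rwa [Set.mem_ofPred_eq, nonsing_inv_mul_cancel_left _ _ hdet] at this

theorem lam_proj_mem [DecidableEq Gal(K/F)]
    (hK : ∀ k : K, P.incl (star k) = star (P.incl k))
    (hdiag : ∀ σ τ, σ ≠ τ → P.gram σ τ = 0)
    {L : Set (Matrix Gal(K/F) Gal(K/F) K)} (hL : IsUnitalHermitianCone P.sharp L) {u : D}
    (hu : P.lam u ∈ L) (d : D) : P.lam (P.incl (P.proj (star d * u * d))) ∈ L := by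
  have hg : P.gram = diagonal fun σ => P.gram σ σ := by
    ext σ τ
    rw [diagonal_apply]
    split_ifs with h
    · rw [h]
    · exact hdiag σ τ h
  have hne : ∀ σ, P.gram σ σ ≠ 0 := by
    have hdet := (isUnit_iff_isUnit_det _).mp (P.isUnit_gram hK)
    rw [hg, det_diagonal, isUnit_iff_ne_zero, Finset.prod_ne_zero_iff] at hdet
    exact fun σ => hdet σ (Finset.mem_univ σ)
  rw [lam_incl, ← sum_single_eq_diagonal]
  refine Finset.sum_induction _ (· ∈ L) (fun a b ha hb => hL.add_mem a ha b hb) hL.zero_mem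
    fun σ _ => ?_
  -- With `k = f(d^* u d)`, the value at `d e_σ` is `A_σσ σ(k)`, and this `p` makes `p p^* A =
  -- A_σσ⁻¹ E_σσ`. The product is `σ(k) E_σσ`, one diagonal summand of `λ(k)`.
  have hσ := P.form_smul_mem hK hL hu (d * P.e σ) (Pi.single σ (P.gram σ σ)⁻¹)
  have hs : star (d * P.e σ) * u * (d * P.e σ) = star (P.e σ) * (star d * u * d) * P.e σ := by
    simp only [star_mul, mul_assoc]
  rw [hs, P.proj_star_e_mul_mul_e hK (hne σ)] at hσ
  convert hσ using 1
  have hst : star (P.gram σ σ) = P.gram σ σ := (P.gram_isHermitian hK).apply σ σ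
  ext i j
  have hi := hne σ
  by_cases hiσ : i = σ
  · subst hiσ
    by_cases hj : j = i
    · subst hj
      simp [vecMulVec_mul, vecMulVec_apply, Pi.star_single, hst]
      field_simp
    · simp [vecMulVec_mul, vecMulVec_apply, Pi.star_single, hdiag _ _ (Ne.symm hj), Ne.symm hj]
  · simp [vecMulVec_mul, vecMulVec_apply, hiσ, Ne.symm hiσ]

end Division

end CrossedProduct

theorem mainTheorem8 {F K D : Type*} [Field F] [Field K] [Algebra F K] [FiniteDimensional F K]
    [IsGalois F K] [DivisionRing D] [Algebra F D] [Algebra.IsCentral F D]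
    [DecidableEq Gal(K/F)] [StarRing D] [StarRing K]
    (P : CrossedProduct F K D)
    (hK : ∀ k : K, P.incl (star k) = star (P.incl k))
    (hreal : IsFormallyRealInvolution P.sharp)
    (M : Set D) (hM : IsUnitalHermitianCone (star : D → D) M) :
    List.TFAE
      [∃ L : Set (Matrix Gal(K/F) Gal(K/F) K), IsUnitalHermitianCone P.sharp L ∧ M = P.lam ⁻¹' L,
        M = P.extension (P.contraction M),
        ∀ u : D, star u = u → (u ∈ M ↔ ∀ d : D, P.incl (P.proj (star d * u * d)) ∈ M)] ∧
    ((∃ k : K, star k ≠ k) →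
      (M = P.extension (P.contraction M) ↔
        ∀ u : D, u ∈ M ↔ ∀ d : D, P.incl (P.proj (star d * u * d)) ∈ M)) := by
  have h23 := P.eq_extension_iff hK hM
  have h2 := P.two_ne_zero_of_cone hM
  constructor
  · tfae_have 2 ↔ 3 := h23
    tfae_have 2 → 1 := fun h => ⟨_, P.extension_contraction_extends hK hM h, h⟩
    tfae_have 1 → 3 := by
      rintro ⟨L, hL, rfl⟩ u hu
      exact ⟨fun h d => P.lam_proj_mem hK (fun _ _ => P.gram_eq_zero_of_ne hK h2 hreal) hL h d,
        P.lam_mem_of_form_mem hK h2 hL hu⟩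
    tfae_finish
  · rintro ⟨k, hk⟩
    refine h23.trans ⟨fun h u => ?_, fun h u _ => h u⟩
    refine ⟨fun hu => (h u (hM.hermitian u hu)).mp hu, fun hu => (h u ?_).mpr hu⟩
    -- Elements of `M` are hermitian, so the form of `A λ(u)` has hermitian values; as `*` is
    -- nontrivial on `K`, this forces `u^* = u`.
    exact P.star_eq_self_of_form hK hk fun d =>
      P.incl.toRingHom.injective ((hK _).trans (hM.hermitian _ (hu d)))
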